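/- Let $f$ be a (real- or complex-valued) function that is real-analytic at $0$. Put $p_f(t)=\frac{e^t-1}{t}f(t)$ (with $p_f(0)=f(0)$) and let $P_{f,n}=p_f^{(n)}(0)$, so that $p_f(t)=\sum_{n\ge 0}\frac{P_{f,n}}{n!}t^n$ near $0$. Assume that the radius of convergence $\rho_f\in[0,+\infty]$ of $\sum_{n\ge0}P_{f,n}s^n$ is non-zero; then $\sum_{n\ge0}\frac{P_{f,n}}{n!}s^n$ converges for all $s\in\mathbb{C}$, and its sum is again denoted by $p_f(s)$. Put $n_f=\lfloor 1/\rho_f\rfloor+1$ (with $1/\infty=0$) and $$s^{(z,f)}=s^z\sum_{k=0}^{\infty}\binom{z}{k}P_{f,k}\,s^{-k},\qquad L(z,f)=\sum_{n=n_f}^{\infty}n^{(-z,f)}\quad(\Re z>1).$$ For $0<\varepsilon<2\pi$ let $\mu$ be the contour that comes from $-\infty$ to $-\varepsilon$ along the lower side of the negative real axis ($\arg s=-\pi$), runs once around the circle $|s|=\varepsilon$ counterclockwise ($\arg s$ from $-\pi$ to $\pi$), and returns to $-\infty$ along the upper side ($\arg s=\pi$), and let $$I(z,f)=\frac{1}{2i\pi}\int_{\mu}\frac{s^{z-1}e^{n_fs}p_f(s)}{1-e^s}\,ds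 .$$ **Theorem.** The series defining $n^{(z,f)}$ ($n\ge n_f$, $z\in\mathbb{C}$) and the series $L(z,f)$ ($\Re z>1$) converge absolutely, and the integral $I(z,f)$ converges absolutely for every $z\in\mathbb{C}$. The function $L(z,f)$ extends to an analytic function on $\mathbb{C}\setminus\{1\}$. If $f(0)\neq0$, the extension has a simple pole at $1$ with residue $f(0)$; if $f(0)=0$, $L(z,f)$ extends to an entire function. For every $0<\varepsilon<2\pi$ and all $z\in\mathbb{C}\setminus\{1\}$, $$L(z,f)=\Gamma(1-z)\,I(z,f)=\frac{\Gamma(1-z)}{2i\pi}\int_{\mu}\frac{s^{z-1}e^{n_fs}p_f(s)}{1-e^s}\,ds,$$ where at the poles $z=2,3,4,\dots$ of $\Gamma(1-z)$ the right-hand side means its limit (the singularities there are removable). -/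

import Mathlib

open scoped Topology

noncomputable section

namespace LCFunction

/-- The function `p_f(t) = (e^t - 1) / t * f(t)`, with the removable singularity at `0` filled in
(its value there is `f 0`). -/
def pFun (f : ℝ → ℂ) (t : ℝ) : ℂ :=
  if t = 0 then f 0 else (Complex.exp t - 1) / t * f t

/-- The P-numbers of `f`: `p_f(t) = ∑ P_{f,n} t^n / n!` near `0`, i.e. `P_{f,n} = p_f^{(n)}(0)`. -/
def pNum (f : ℝ → ℂ) (n : ℕ) : ℂ := iteratedDeriv n (pFun f) 0

/-- The radius of convergence `ρ_f ∈ [0, ∞]` of the power series `∑ P_{f,n} s^n`. -/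
def rho (f : ℝ → ℂ) : ENNReal := (FormalMultilinearSeries.ofScalars ℂ (pNum f)).radius

/-- `n_f = ⌊1 / ρ_f⌋ + 1`, where `1 / ∞ = 0`. -/
def nf (f : ℝ → ℂ) : ℕ := ⌊((rho f)⁻¹).toReal⌋₊ + 1

/-- The extension of `p_f` to the complex plane by the sum of its Maclaurin series, which converges
everywhere as soon as `ρ_f > 0`. -/
def pExt (f : ℝ → ℂ) (s : ℂ) : ℂ := ∑' n : ℕ, pNum f n / (n.factorial : ℂ) * s ^ n

/-- The generalized binomial coefficient `z (z - 1) ⋯ (z - k + 1) / k!`. -/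
def binom (z : ℂ) (k : ℕ) : ℂ := (∏ j ∈ Finset.range k, (z - j)) / (k.factorial : ℂ)

/-- The `k`-th term of the series in `s^{(z,f)} = s^z ∑_k binom(z,k) P_{f,k} (1/s)^k`. -/
def gpowTerm (f : ℝ → ℂ) (s z : ℂ) (k : ℕ) : ℂ := binom z k * pNum f k * (1 / s) ^ k

/-- The generalized power `s^{(z,f)} = s^z ∑_k binom(z,k) P_{f,k} (1/s)^k`
(principal branch of `s^z`). -/
def gpow (f : ℝ → ℂ) (s z : ℂ) : ℂ := s ^ z * ∑' k : ℕ, gpowTerm f s z k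

/-- The LC-series `L(z,f) = ∑_{n ≥ n_f} n^{(-z,f)}`, summed over `n = n_f + m`, `m ≥ 0`. -/
def LSum (f : ℝ → ℂ) (z : ℂ) : ℂ := ∑' m : ℕ, gpow f ((nf f + m : ℕ) : ℂ) (-z)

/-- The power `s ^ w` at `s = r e^{iθ}` for the branch of the argument given by `θ`, that is
`r ^ w * e^{iθw}` for `r > 0`. -/
def polarPow (r θ : ℝ) (w : ℂ) : ℂ := (r : ℂ) ^ w * Complex.exp (Complex.I * θ * w)

/-- The point `r e^{iθ}`. -/
def polarPt (r θ : ℝ) : ℂ := (r : ℂ) * Complex.exp (Complex.I * θ)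

/-- The contour `μ` with radius `ε` consists of
* `μ₁`: `s = r e^{-iπ}`, `r` from `+∞` down to `ε`;
* `μ₂`: `s = ε e^{iθ}`, `θ` from `-π` to `π`;
* `μ₃`: `s = r e^{iπ}`, `r` from `ε` up to `+∞`.

A function on `μ` (with the two sides of the cut kept apart) is a function `F r θ` of polar
coordinates. This is `∫_μ F ds`, with `ds = e^{iθ} dr` on the rays and `ds = iεe^{iθ} dθ` on the
circle. -/
def hankelIntegral (ε : ℝ) (F : ℝ → ℝ → ℂ) : ℂ :=
  (-∫ r in Set.Ioi ε, F r (-Real.pi) * Complex.exp (Complex.I * (-Real.pi : ℝ)))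
    + (∫ θ in (-Real.pi)..Real.pi, F ε θ * (Complex.I * polarPt ε θ))
    + ∫ r in Set.Ioi ε, F r Real.pi * Complex.exp (Complex.I * (Real.pi : ℝ))

/-- Absolute convergence of `∫_μ F ds` on each of the three parts of `μ`. -/
def HankelIntegrable (ε : ℝ) (F : ℝ → ℝ → ℂ) : Prop :=
  MeasureTheory.IntegrableOn (fun r => F r (-Real.pi)) (Set.Ioi ε) ∧
  IntervalIntegrable (fun θ => F ε θ) MeasureTheory.volume (-Real.pi) Real.pi ∧
  MeasureTheory.IntegrableOn (fun r => F r Real.pi) (Set.Ioi ε)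

/-- The integrand `s^{z-1} e^{n_f s} p_f(s) / (1 - e^s)` at `s = r e^{iθ}`. -/
def integrand (f : ℝ → ℂ) (z : ℂ) (r θ : ℝ) : ℂ :=
  polarPow r θ (z - 1) * Complex.exp (nf f * polarPt r θ) * pExt f (polarPt r θ)
    / (1 - Complex.exp (polarPt r θ))

/-- `I(z,f) = 1/(2iπ) ∫_μ s^{z-1} e^{n_f s} p_f(s) / (1 - e^s) ds`, where `μ` has radius `ε`. -/
def IInt (ε : ℝ) (f : ℝ → ℂ) (z : ℂ) : ℂ :=
  1 / (2 * Complex.I * Real.pi) * hankelIntegral ε (integrand f z)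

end LCFunction

end

noncomputable section

namespace LCFunction

open Filter Complex MeasureTheory Set

/-! Since `1/ρ_f < n_f`, the P-numbers satisfy `|P_k| ≤ C A^k` for some `A < n_f`, so `p_f` is
entire of exponential type at most `A`, strictly below `n_f`. Expanding `p_f(-t)` and integrating
termwise against `t^(z-1) e^(-nt)` gives the Gamma integral of `n^(-z,f)` (`Gamma_mul_gpow`).
Summing the geometric series in `n` then yields, for `Re z > 1`, `Γ(z) L(z,f) = M(z)`, the Mellin
transform of `e^(-n_f t) p_f(-t) / (1 - e^(-t))` (`Gamma_mul_LSum`).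

The contour integral `J` is entire: on the rays the integrand decays exponentially, and the circle
is compact. For `Re z > 1` it equals `sin(πz)/π · M(z)` (`hankel_eq_mellin`). No contour is
deformed: the rays give the part of `M` over `(ε, ∞)`, and the circle gives exactly the part over
`(0, ε)`, as a termwise integration of the Taylor series of `s e^(n_f s) p_f(s) / (1 - e^s)` shows
(`circle_eq_ray`).

The reflection formula turns this into `L = Γ(1-z) J(z)`, which continues `L`. Near `1`, `Γ(1-z) =
-Γ(2-z)/(z-1)` and `J(1) = -f(0)`, which gives the residue `f(0)`. At `2, 3, …` the formula `M/Γ`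
shows that the continuation is regular. -/

/-! ### Growth of the P-numbers and convergence of the series -/

theorem exists_norm_pNum_le {f : ℝ → ℂ} (hρ : rho f ≠ 0) :
    ∃ C A : ℝ, 0 < C ∧ 0 < A ∧ A < nf f ∧ ∀ k, ‖pNum f k‖ ≤ C * A ^ k := by
  have hfin : (rho f)⁻¹ ≠ ⊤ := by simpa using hρ
  set R := ((rho f)⁻¹).toReal with hR
  have hR0 : 0 ≤ R := ENNReal.toReal_nonneg
  have hRn : R < nf f := by
    have := Nat.lt_floor_add_one R
    simpa [nf, ← hR] using this
  -- The `+ 1` in `n_f` makes the gap above `1/ρ_f` strict. Taking `A` strictly inside it places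
  -- `1/A` below the radius of convergence, and `A > 0` even when `ρ_f = ∞`.
  obtain ⟨A, hRA, hAn⟩ := exists_between hRn
  have hA : 0 < A := hR0.trans_lt hRA
  have hlt : ((A.toNNReal⁻¹ : NNReal) : ENNReal) <
      (FormalMultilinearSeries.ofScalars ℂ (pNum f)).radius := by
    change _ < rho f
    rw [ENNReal.coe_inv (by simpa using hA), ENNReal.inv_lt_iff_inv_lt,
      ← ENNReal.ofReal_toReal hfin]
    exact (ENNReal.ofReal_lt_ofReal_iff hA).2 hRA
  obtain ⟨C, hC, h⟩ := FormalMultilinearSeries.norm_mul_pow_le_of_lt_radius _ hlt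
  refine ⟨C, A, hC, hA, hAn, fun k => ?_⟩
  have hk := h k
  rw [FormalMultilinearSeries.ofScalars_norm, NNReal.coe_inv, Real.coe_toNNReal A hA.le, inv_pow,
    ← div_eq_mul_inv, div_le_iff₀ (by positivity)] at hk
  exact hk

theorem binom_succ (z : ℂ) (k : ℕ) : binom z (k + 1) = (z - k) / (k + 1) * binom z k := by
  have h1 : ((k.factorial : ℕ) : ℂ) ≠ 0 := by exact_mod_cast k.factorial_ne_zero
  have h2 : (k : ℂ) + 1 ≠ 0 := by exact_mod_cast k.succ_ne_zero
  rw [binom, binom, Finset.prod_range_succ, Nat.factorial_succ]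
  push_cast
  field_simp

theorem summable_norm_binom_mul_pow (z : ℂ) {q : ℝ} (hq0 : 0 ≤ q) (hq : q < 1) :
    Summable fun k : ℕ => ‖binom z k‖ * q ^ k := by
  obtain ⟨r, hqr, hr⟩ := exists_between hq
  have hr0 : 0 < r := hq0.trans_lt hqr
  refine summable_of_ratio_norm_eventually_le hr ?_
  -- This is what `q (‖z‖ + k) ≤ r (k + 1)`, the ratio test with ratio `r`, requires up to the spare
  -- term `r`.
  have hev : ∀ᶠ k : ℕ in atTop, q * ‖z‖ ≤ (r - q) * k :=
    ((tendsto_natCast_atTop_atTop (R := ℝ)).const_mul_atTop (sub_pos.2 hqr)).eventually_ge_atTop _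
  filter_upwards [hev] with k hk
  have hk1 : (0 : ℝ) < k + 1 := by positivity
  have hn : ‖(z - k) / (k + 1 : ℂ)‖ * q ≤ r := by
    have h1 : ‖(k + 1 : ℂ)‖ = k + 1 := by exact_mod_cast Complex.norm_natCast (k + 1)
    have h2 : ‖z - k‖ ≤ ‖z‖ + k := by simpa using norm_sub_le z (k : ℂ)
    rw [norm_div, h1, div_mul_eq_mul_div, div_le_iff₀ hk1]
    nlinarith
  rw [Real.norm_of_nonneg (by positivity), Real.norm_of_nonneg (by positivity), binom_succ,
    norm_mul]
  calc _ = ‖(z - k) / (k + 1 : ℂ)‖ * q * (‖binom z k‖ * q ^ k) := by ring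
    _ ≤ _ := by gcongr

/-- The majorant does not depend on `n ≥ N`. It therefore serves both for a fixed `n` and for the
sum over `n`, where it leaves only `∑ n^(-Re z)`. -/
theorem norm_gpowTerm_le {f : ℝ → ℂ} {C A : ℝ} (hC : 0 < C) (hA : 0 < A)
    (hP : ∀ k, ‖pNum f k‖ ≤ C * A ^ k) {N n : ℕ} (hN : 0 < N) (hn : N ≤ n) (z : ℂ) (k : ℕ) :
    ‖gpowTerm f n z k‖ ≤ C * (‖binom z k‖ * (A / N) ^ k) := by
  have hN' : (0 : ℝ) < N := by exact_mod_cast hN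
  have hn' : (N : ℝ) ≤ n := by exact_mod_cast hn
  rw [gpowTerm, norm_mul, norm_mul, norm_pow, norm_div, norm_one, Complex.norm_natCast]
  calc _ ≤ ‖binom z k‖ * (C * A ^ k) * (1 / (N : ℝ)) ^ k := by
        gcongr
        exact hP k
    _ = _ := by rw [div_pow, div_pow]; ring

theorem summable_norm_gpowTerm {f : ℝ → ℂ} (hρ : rho f ≠ 0) {n : ℕ} (hn : nf f ≤ n) (z : ℂ) :
    Summable fun k => ‖gpowTerm f n z k‖ := by
  obtain ⟨C, A, hC, hA, hAn, hP⟩ := exists_norm_pNum_le hρ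
  have hN : 0 < nf f := Nat.succ_pos _
  have hq : A / nf f < 1 := (div_lt_one (hA.trans hAn)).2 hAn
  exact .of_nonneg_of_le (fun _ => norm_nonneg _)
    (fun k => norm_gpowTerm_le hC hA hP hN hn z k)
    ((summable_norm_binom_mul_pow z (by positivity) hq).mul_left C)

theorem summable_norm_gpow {f : ℝ → ℂ} (hρ : rho f ≠ 0) {z : ℂ} (hz : 1 < z.re) :
    Summable fun m : ℕ => ‖gpow f ((nf f + m : ℕ) : ℂ) (-z)‖ := by
  obtain ⟨C, A, hC, hA, hAn, hP⟩ := exists_norm_pNum_le hρ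
  have hN : 0 < nf f := Nat.succ_pos _
  have hq : A / nf f < 1 := (div_lt_one (hA.trans hAn)).2 hAn
  have hs := (summable_norm_binom_mul_pow (-z) (by positivity) hq).mul_left C
  have hx : Summable fun m : ℕ => ((nf f + m : ℕ) : ℝ) ^ (-z.re) := by
    have := (summable_nat_add_iff (nf f)).2 (Real.summable_nat_rpow.2 (neg_lt_neg hz))
    simpa only [add_comm] using this
  refine .of_nonneg_of_le (fun _ => norm_nonneg _) (fun m => ?_)
    (hx.mul_right (∑' k, C * (‖binom (-z) k‖ * (A / nf f) ^ k)))
  rw [gpow, norm_mul, Complex.norm_natCast_cpow_of_pos (by omega), Complex.neg_re]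
  gcongr
  have ht := summable_norm_gpowTerm hρ (Nat.le_add_right (nf f) m) (-z)
  refine (norm_tsum_le_tsum_norm ht).trans (ht.tsum_le_tsum (fun k => ?_) hs)
  exact norm_gpowTerm_le hC hA hP hN (Nat.le_add_right _ _) (-z) k

/-! ### The entire function `p_f` and its exponential type -/

theorem norm_pExt_term_le {f : ℝ → ℂ} {C A : ℝ} (hP : ∀ k, ‖pNum f k‖ ≤ C * A ^ k)
    {r : ℝ} {s : ℂ} (hs : ‖s‖ ≤ r) (k : ℕ) :
    ‖pNum f k / (k.factorial : ℂ) * s ^ k‖ ≤ C * ((A * r) ^ k / k.factorial) := by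
  have hk := (norm_nonneg _).trans (hP k)
  rw [norm_mul, norm_div, norm_pow, Complex.norm_natCast]
  calc _ ≤ C * A ^ k / k.factorial * r ^ k := by
        gcongr
        exact hP k
    _ = _ := by ring

theorem summable_exp_majorant (C A r : ℝ) :
    Summable fun k : ℕ => C * ((A * r) ^ k / k.factorial) :=
  (Real.summable_pow_div_factorial (A * r)).mul_left C

theorem tsum_exp_majorant (C A r : ℝ) :
    ∑' k : ℕ, C * ((A * r) ^ k / k.factorial) = C * Real.exp (A * r) := by
  rw [tsum_mul_left, Real.exp_eq_exp_ℝ, NormedSpace.exp_eq_tsum_div]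

theorem differentiable_pExt {f : ℝ → ℂ} (hρ : rho f ≠ 0) : Differentiable ℂ (pExt f) := by
  obtain ⟨C, A, hC, hA, hAn, hP⟩ := exists_norm_pNum_le hρ
  intro s
  have hU : IsOpen (Metric.ball (0 : ℂ) (‖s‖ + 1)) := Metric.isOpen_ball
  have := differentiableOn_tsum_of_summable_norm (summable_exp_majorant C A (‖s‖ + 1))
    (F := fun (k : ℕ) (s : ℂ) => pNum f k / (k.factorial : ℂ) * s ^ k)
    (fun k => by fun_prop) hU
    (fun k w hw => norm_pExt_term_le hP (by simpa using (mem_ball_zero_iff.1 hw).le) k)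
  exact this.differentiableAt (hU.mem_nhds (by simp))

theorem norm_pExt_le {f : ℝ → ℂ} {C A : ℝ} (hP : ∀ k, ‖pNum f k‖ ≤ C * A ^ k) (s : ℂ) :
    ‖pExt f s‖ ≤ C * Real.exp (A * ‖s‖) := by
  rw [← tsum_exp_majorant]
  exact tsum_of_norm_bounded (summable_exp_majorant C A ‖s‖).hasSum
    (norm_pExt_term_le hP le_rfl)

theorem hasSum_pExt {f : ℝ → ℂ} {C A : ℝ} (hP : ∀ k, ‖pNum f k‖ ≤ C * A ^ k) (s : ℂ) :
    HasSum (fun k : ℕ => pNum f k / (k.factorial : ℂ) * s ^ k) (pExt f s) :=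
  (Summable.of_norm_bounded (summable_exp_majorant C A ‖s‖) (norm_pExt_term_le hP le_rfl)).hasSum

theorem pExt_zero (f : ℝ → ℂ) : pExt f 0 = f 0 := by
  rw [pExt, tsum_eq_single 0 (by simp +contextual)]
  simp [pNum, pFun]

/-! ### The kernel on the negative axis: Mellin transforms of it and of its tail -/

theorem inv_one_sub_exp_neg_le {r : ℝ} (hr : 0 < r) : (1 - Real.exp (-r))⁻¹ ≤ 1 + r⁻¹ := by
  have h1 : r + 1 ≤ Real.exp r := Real.add_one_le_exp r
  have h2 : Real.exp (-r) ≤ (r + 1)⁻¹ := by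
    rw [Real.exp_neg]
    exact inv_anti₀ (by positivity) h1
  have h3 : r / (r + 1) ≤ 1 - Real.exp (-r) := by
    have : r / (r + 1) = 1 - (r + 1)⁻¹ := by field_simp; ring
    linarith
  calc _ ≤ (r / (r + 1))⁻¹ := inv_anti₀ (by positivity) h3
    _ = _ := by field_simp

/-- The function `e^{N s} p(s) / (1 - e^s)` at `s = -r`. -/
def kernel (N : ℕ) (p : ℂ → ℂ) (r : ℝ) : ℂ :=
  exp (N * (-r : ℂ)) * p (-r) / (1 - exp (-r))

theorem norm_one_sub_exp_neg {r : ℝ} (hr : 0 < r) :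
    ‖1 - exp (-r : ℂ)‖ = 1 - Real.exp (-r) := by
  have h : (1 - exp (-r : ℂ)) = ((1 - Real.exp (-r) : ℝ) : ℂ) := by push_cast; rfl
  rw [h, Complex.norm_real, Real.norm_of_nonneg]
  have : Real.exp (-r) ≤ 1 := Real.exp_le_one_iff.2 (by linarith)
  linarith

theorem one_sub_exp_neg_pos {r : ℝ} (hr : 0 < r) : 0 < 1 - Real.exp (-r) := by
  have : Real.exp (-r) < 1 := Real.exp_lt_one_iff.2 (by linarith)
  linarith

theorem one_sub_exp_neg_ne_zero {r : ℝ} (hr : 0 < r) : 1 - exp (-r : ℂ) ≠ 0 := by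
  rw [← norm_pos_iff, norm_one_sub_exp_neg hr]
  exact one_sub_exp_neg_pos hr

theorem norm_exp_mul_le {N : ℕ} {p : ℂ → ℂ} {C A : ℝ}
    (hb : ∀ s, ‖p s‖ ≤ C * Real.exp (A * ‖s‖)) {r : ℝ} (hr : 0 ≤ r) :
    ‖exp (N * (-r : ℂ)) * p (-r)‖ ≤ C * Real.exp (-(N - A) * r) := by
  have h1 : ‖exp (N * (-r : ℂ))‖ = Real.exp (-(N * r)) := by
    rw [Complex.norm_exp]; simp
  have h2 := hb (-r)
  rw [norm_neg, Complex.norm_real, Real.norm_of_nonneg hr] at h2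
  rw [norm_mul, h1]
  calc _ ≤ Real.exp (-(N * r)) * (C * Real.exp (A * r)) := by gcongr
    _ = _ := by
      rw [mul_left_comm, ← Real.exp_add]; ring_nf

theorem norm_kernel_le {N : ℕ} {p : ℂ → ℂ} {C A : ℝ}
    (hb : ∀ s, ‖p s‖ ≤ C * Real.exp (A * ‖s‖)) {r : ℝ} (hr : 0 < r) :
    ‖kernel N p r‖ ≤ C * Real.exp (-(N - A) * r) * (1 + r⁻¹) := by
  rw [kernel, norm_div, norm_one_sub_exp_neg hr, div_eq_mul_inv]
  have := norm_exp_mul_le (N := N) hb hr.le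
  have h0 := (norm_nonneg _).trans this
  have h1 := one_sub_exp_neg_pos hr
  gcongr
  exact inv_one_sub_exp_neg_le hr

theorem continuousOn_kernel (N : ℕ) {p : ℂ → ℂ} (hp : Differentiable ℂ p) :
    ContinuousOn (kernel N p) (Ioi 0) := by
  have := hp.continuous
  unfold kernel
  refine ContinuousOn.div (by fun_prop) (by fun_prop) fun r hr => one_sub_exp_neg_ne_zero hr

theorem kernel_isBigO_atTop {N : ℕ} {p : ℂ → ℂ} {C A : ℝ}
    (hb : ∀ s, ‖p s‖ ≤ C * Real.exp (A * ‖s‖)) :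
    kernel N p =O[atTop] fun r => Real.exp (-(N - A) * r) := by
  refine .of_bound (C * 2) ?_
  filter_upwards [eventually_ge_atTop 1] with r hr
  have hr0 : 0 < r := by linarith
  have h0 := (norm_nonneg _).trans (norm_exp_mul_le (N := N) hb hr0.le)
  have h1 : 1 + r⁻¹ ≤ 2 := by
    have := inv_le_one_of_one_le₀ hr
    linarith
  rw [Real.norm_of_nonneg (Real.exp_pos _).le]
  calc _ ≤ C * Real.exp (-(N - A) * r) * (1 + r⁻¹) := norm_kernel_le hb hr0
    _ ≤ C * Real.exp (-(N - A) * r) * 2 := by gcongr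
    _ = _ := by ring

/-- The zero of `1 - e^(-r)` at `0` costs one power of `r`; this is the source of the condition `Re
z > 1`. -/
theorem kernel_isBigO_zero {N : ℕ} {p : ℂ → ℂ} {C A : ℝ} (hC : 0 < C) (hAN : A < N)
    (hb : ∀ s, ‖p s‖ ≤ C * Real.exp (A * ‖s‖)) :
    kernel N p =O[𝓝[>] 0] fun r : ℝ => r ^ (-1 : ℝ) := by
  refine .of_bound (C * 2) ?_
  filter_upwards [Ioo_mem_nhdsGT (zero_lt_one' ℝ)] with r hr
  have hr0 : 0 < r := hr.1
  have h1 : 1 ≤ r⁻¹ := (one_le_inv₀ hr0).2 hr.2.le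
  have h2 : Real.exp (-(N - A) * r) ≤ 1 := by
    rw [Real.exp_le_one_iff]
    nlinarith
  rw [Real.rpow_neg_one, Real.norm_of_nonneg (by positivity)]
  calc _ ≤ C * Real.exp (-(N - A) * r) * (1 + r⁻¹) := norm_kernel_le hb hr0
    _ ≤ C * 1 * (r⁻¹ + r⁻¹) := by gcongr
    _ = _ := by ring

theorem locallyIntegrableOn_kernel (N : ℕ) {p : ℂ → ℂ} (hp : Differentiable ℂ p) :
    LocallyIntegrableOn (kernel N p) (Ioi 0) :=
  (continuousOn_kernel N hp).locallyIntegrableOn measurableSet_Ioi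

theorem mellinConvergent_kernel {N : ℕ} {p : ℂ → ℂ} {C A : ℝ} (hp : Differentiable ℂ p)
    (hC : 0 < C) (hAN : A < N) (hb : ∀ s, ‖p s‖ ≤ C * Real.exp (A * ‖s‖)) {z : ℂ}
    (hz : 1 < z.re) : MellinConvergent (kernel N p) z :=
  mellinConvergent_of_isBigO_rpow_exp (sub_pos.2 hAN) (locallyIntegrableOn_kernel N hp)
    (kernel_isBigO_atTop hb) (kernel_isBigO_zero hC hAN hb) hz

theorem differentiableAt_mellin_kernel {N : ℕ} {p : ℂ → ℂ} {C A : ℝ} (hp : Differentiable ℂ p)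
    (hC : 0 < C) (hAN : A < N) (hb : ∀ s, ‖p s‖ ≤ C * Real.exp (A * ‖s‖)) {z : ℂ}
    (hz : 1 < z.re) : DifferentiableAt ℂ (mellin (kernel N p)) z :=
  mellin_differentiableAt_of_isBigO_rpow_exp (sub_pos.2 hAN) (locallyIntegrableOn_kernel N hp)
    (kernel_isBigO_atTop hb) (kernel_isBigO_zero hC hAN hb) hz

/-- The kernel cut off at `ε`. -/
def tailKernel (ε : ℝ) (N : ℕ) (p : ℂ → ℂ) : ℝ → ℂ := (Ioi ε).indicator (kernel N p)

theorem locallyIntegrableOn_tailKernel (ε : ℝ) (N : ℕ) {p : ℂ → ℂ} (hp : Differentiable ℂ p) :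
    LocallyIntegrableOn (tailKernel ε N p) (Ioi 0) := by
  intro x hx
  obtain ⟨s, hs, hi⟩ := locallyIntegrableOn_kernel N hp x hx
  exact ⟨s, hs, hi.indicator measurableSet_Ioi⟩

theorem tailKernel_isBigO_atTop (ε : ℝ) {N : ℕ} {p : ℂ → ℂ} {C A : ℝ}
    (hb : ∀ s, ‖p s‖ ≤ C * Real.exp (A * ‖s‖)) :
    tailKernel ε N p =O[atTop] fun r => Real.exp (-(N - A) * r) := by
  refine (kernel_isBigO_atTop hb).congr' ?_ EventuallyEq.rfl
  filter_upwards [eventually_gt_atTop ε] with r hr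
  exact (indicator_of_mem (mem_Ioi.2 hr) _).symm

/-- The tail vanishes near `0`, so every exponent `b` is allowed and the Mellin transform of the
tail is entire. -/
theorem tailKernel_isBigO_zero {ε : ℝ} (hε : 0 < ε) (N : ℕ) (p : ℂ → ℂ) (b : ℝ) :
    tailKernel ε N p =O[𝓝[>] 0] fun r : ℝ => r ^ (-b) := by
  refine (Asymptotics.isBigO_zero _ _).congr' (f₁ := fun _ => 0) ?_ EventuallyEq.rfl
  filter_upwards [Ioo_mem_nhdsGT hε] with r hr
  exact (indicator_of_notMem (by simpa using hr.2.le) _).symm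

theorem mellinConvergent_tailKernel {ε : ℝ} (hε : 0 < ε) {N : ℕ} {p : ℂ → ℂ} {C A : ℝ}
    (hp : Differentiable ℂ p) (hAN : A < N) (hb : ∀ s, ‖p s‖ ≤ C * Real.exp (A * ‖s‖)) (z : ℂ) :
    MellinConvergent (tailKernel ε N p) z :=
  mellinConvergent_of_isBigO_rpow_exp (sub_pos.2 hAN) (locallyIntegrableOn_tailKernel ε N hp)
    (tailKernel_isBigO_atTop ε hb) (tailKernel_isBigO_zero hε N p _) (sub_one_lt z.re)

theorem differentiable_mellin_tailKernel {ε : ℝ} (hε : 0 < ε) {N : ℕ} {p : ℂ → ℂ} {C A : ℝ}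
    (hp : Differentiable ℂ p) (hAN : A < N) (hb : ∀ s, ‖p s‖ ≤ C * Real.exp (A * ‖s‖)) :
    Differentiable ℂ (mellin (tailKernel ε N p)) := fun z =>
  mellin_differentiableAt_of_isBigO_rpow_exp (sub_pos.2 hAN)
    (locallyIntegrableOn_tailKernel ε N hp)
    (tailKernel_isBigO_atTop ε hb) (tailKernel_isBigO_zero hε N p _) (sub_one_lt z.re)

theorem cpow_smul_tailKernel (ε : ℝ) (N : ℕ) (p : ℂ → ℂ) (z : ℂ) :
    (fun r : ℝ => (r : ℂ) ^ (z - 1) • tailKernel ε N p r) =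
      (Ioi ε).indicator fun r : ℝ => (r : ℂ) ^ (z - 1) * kernel N p r := by
  ext r
  simp only [tailKernel, smul_eq_mul, indicator_apply]
  split_ifs <;> simp

theorem integrableOn_Ioi_cpow_mul_kernel {ε : ℝ} (hε : 0 < ε) {N : ℕ} {p : ℂ → ℂ} {C A : ℝ}
    (hp : Differentiable ℂ p) (hAN : A < N) (hb : ∀ s, ‖p s‖ ≤ C * Real.exp (A * ‖s‖)) (z : ℂ) :
    IntegrableOn (fun r : ℝ => (r : ℂ) ^ (z - 1) * kernel N p r) (Ioi ε) := by
  have h := mellinConvergent_tailKernel hε hp hAN hb z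
  rw [MellinConvergent, cpow_smul_tailKernel, IntegrableOn,
    integrable_indicator_iff measurableSet_Ioi, IntegrableOn,
    Measure.restrict_restrict measurableSet_Ioi,
    inter_eq_left.2 (Ioi_subset_Ioi hε.le)] at h
  exact h

theorem mellin_tailKernel {ε : ℝ} (hε : 0 < ε) (N : ℕ) (p : ℂ → ℂ) (z : ℂ) :
    mellin (tailKernel ε N p) z = ∫ r in Ioi ε, (r : ℂ) ^ (z - 1) * kernel N p r := by
  rw [mellin, cpow_smul_tailKernel, setIntegral_indicator measurableSet_Ioi,
    inter_eq_right.2 (Ioi_subset_Ioi hε.le)]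

theorem mellin_kernel_eq_add {ε : ℝ} (hε : 0 < ε) {N : ℕ} {p : ℂ → ℂ} {C A : ℝ}
    (hp : Differentiable ℂ p) (hC : 0 < C) (hAN : A < N)
    (hb : ∀ s, ‖p s‖ ≤ C * Real.exp (A * ‖s‖)) {z : ℂ} (hz : 1 < z.re) :
    mellin (kernel N p) z = (∫ r in (0 : ℝ)..ε, (r : ℂ) ^ (z - 1) * kernel N p r)
      + mellin (tailKernel ε N p) z := by
  have h := mellinConvergent_kernel hp hC hAN hb hz
  rw [mellin_tailKernel hε, mellin]
  exact (intervalIntegral.integral_interval_add_Ioi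
    (f := fun r : ℝ => (r : ℂ) ^ (z - 1) * kernel N p r) h
    (integrableOn_Ioi_cpow_mul_kernel hε hp hAN hb z)).symm

/-! ### Integrals over the circle -/

theorem polarPow_eq_exp {r : ℝ} (hr : 0 < r) (θ : ℝ) (w : ℂ) :
    polarPow r θ w = exp (w * (Real.log r + I * θ)) := by
  rw [polarPow, cpow_def_of_ne_zero (by exact_mod_cast hr.ne'), ← ofReal_log hr.le, ← exp_add]
  ring_nf

theorem norm_polarPt {r : ℝ} (hr : 0 ≤ r) (θ : ℝ) : ‖polarPt r θ‖ = r := by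
  rw [polarPt, norm_mul, mul_comm I, norm_exp_ofReal_mul_I, mul_one, norm_real,
    Real.norm_of_nonneg hr]

theorem polarPt_pi (r : ℝ) : polarPt r Real.pi = -r := by
  rw [polarPt, mul_comm I, exp_pi_mul_I]; ring

theorem polarPt_neg_pi (r : ℝ) : polarPt r (-Real.pi) = -r := by
  rw [polarPt, mul_comm I, ofReal_neg, neg_mul, exp_neg, exp_pi_mul_I]; norm_num

theorem continuous_polarPt (r : ℝ) : Continuous (polarPt r) := by
  unfold polarPt; fun_prop

/-- Integrals `∫_{-π}^π s^{z-1} k(θ) dθ`, `s = ε e^{iθ}`, are entire functions of `z`. -/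
theorem differentiable_circle {ε : ℝ} (hε : 0 < ε) {k : ℝ → ℂ} (hk : Continuous k) :
    Differentiable ℂ fun z => ∫ θ in (-Real.pi)..Real.pi, polarPow ε θ (z - 1) * k θ := by
  simp only [polarPow_eq_exp hε]
  intro z₀
  set F' : ℂ → ℝ → ℂ := fun z θ =>
    exp ((z - 1) * (Real.log ε + I * θ)) * (Real.log ε + I * θ) * k θ with hF'
  have hcont : Continuous fun q : ℂ × ℝ => F' q.1 q.2 := by
    simp only [hF']; fun_prop
  -- Compactness of `closedBall z₀ 1 × [-π, π]` bounds the `z`-derivative by a constant, which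
  -- dominates.
  obtain ⟨B, hB⟩ := ((isCompact_closedBall z₀ 1).prod
    (isCompact_Icc (a := -Real.pi) (b := Real.pi))).exists_bound_of_continuousOn hcont.continuousOn
  refine (intervalIntegral.hasDerivAt_integral_of_dominated_loc_of_deriv_le
    (F := fun z θ => exp ((z - 1) * (Real.log ε + I * θ)) * k θ)
    (F' := F') (bound := fun _ => B) (Metric.closedBall_mem_nhds z₀ one_pos)
    (.of_forall fun z => ?_) ?_ ?_ ?_ ?_ ?_).2.differentiableAt
  · exact Continuous.aestronglyMeasurable (by fun_prop)
  · have : Continuous fun θ : ℝ => exp ((z₀ - 1) * (Real.log ε + I * θ)) * k θ := by fun_prop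
    exact this.intervalIntegrable _ _
  · have : Continuous fun θ : ℝ => F' z₀ θ := by simp only [hF']; fun_prop
    exact this.aestronglyMeasurable
  · refine .of_forall fun θ hθ z hz => hB (z, θ) ⟨hz, ?_⟩
    rw [uIoc_of_le (by linarith [Real.pi_pos])] at hθ
    exact Ioc_subset_Icc_self hθ
  · exact intervalIntegrable_const
  · refine .of_forall fun θ _ z _ => ?_
    have := ((((hasDerivAt_id z).sub_const 1).mul_const (Real.log ε + I * θ)).cexp).mul_const (k θ)
    simpa [hF'] using this

/-- Absolute convergence at the single point `s = ε` dominates the series on the whole circle. -/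
theorem hasSum_circle {ε : ℝ} (hε : 0 < ε) {a : ℕ → ℂ} {h : ℂ → ℂ}
    (hsum : ∀ s : ℂ, ‖s‖ ≤ ε → HasSum (fun k => a k * s ^ k) (h s)) (z : ℂ) :
    HasSum (fun k : ℕ => ∫ θ in (-Real.pi)..Real.pi,
        polarPow ε θ (z - 1) * (a k * polarPt ε θ ^ k * I))
      (∫ θ in (-Real.pi)..Real.pi, polarPow ε θ (z - 1) * (h (polarPt ε θ) * I)) := by
  have hcp := continuous_polarPt ε
  have hcw : Continuous fun θ => polarPow ε θ (z - 1) := by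
    simp only [polarPow_eq_exp hε]; fun_prop
  have hsε : Summable fun k => ‖a k‖ * ε ^ k := by
    have := (hsum ε (by simp [abs_of_pos hε])).summable.norm
    simpa [abs_of_pos hε] using this
  refine intervalIntegral.hasSum_integral_of_dominated_convergence
    (fun k θ => ‖polarPow ε θ (z - 1)‖ * (‖a k‖ * ε ^ k)) (fun k => ?_) (fun k => ?_) ?_ ?_ ?_
  · exact Continuous.aestronglyMeasurable (by fun_prop)
  · refine .of_forall fun θ _ => ?_
    simp [norm_polarPt hε.le]
  · exact .of_forall fun θ _ => hsε.mul_left _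
  · simp only [tsum_mul_left]
    exact Continuous.intervalIntegrable (by fun_prop) _ _
  · refine .of_forall fun θ _ => ?_
    exact ((hsum _ (norm_polarPt hε.le θ).le).mul_right I).mul_left _

theorem polarPow_mul_polarPt_pow {ε : ℝ} (hε : 0 < ε) (θ : ℝ) (w : ℂ) (k : ℕ) :
    polarPow ε θ w * polarPt ε θ ^ k = (ε : ℂ) ^ (w + k) * exp (I * (w + k) * θ) := by
  have h0 : (ε : ℂ) ≠ 0 := by exact_mod_cast hε.ne'
  rw [polarPow, polarPt, cpow_add _ _ h0, cpow_natCast, mul_pow, ← exp_nat_mul,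
    show I * (w + k) * θ = I * θ * w + k * (I * θ) by ring, exp_add]
  ring

/-- The jump of `s^(w-1+k)` across the cut depends on `k` only through a sign, so one factor
`sin(πw)` comes out of the whole series. -/
theorem exp_I_pi_sub (w : ℂ) (k : ℕ) :
    exp (I * (w - 1 + k) * Real.pi) - exp (I * (w - 1 + k) * (-Real.pi : ℝ)) =
      -(-1) ^ k * (2 * I * sin (Real.pi * w)) := by
  have h1 : exp (I * (w - 1 + k) * Real.pi) = -(-1) ^ k * exp (Real.pi * w * I) := by
    rw [show I * (w - 1 + k) * Real.pi = Real.pi * w * I - Real.pi * I + k * (Real.pi * I) by ring,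
      exp_add, exp_sub, exp_nat_mul, exp_pi_mul_I]
    ring
  have h2 : exp (I * (w - 1 + k) * (-Real.pi : ℝ)) = -(-1) ^ k * exp (-(Real.pi * w) * I) := by
    rw [show I * (w - 1 + k) * (-Real.pi : ℝ) =
        -(Real.pi * w) * I - (-(Real.pi * I)) + k * (-(Real.pi * I)) by push_cast; ring,
      exp_add, exp_sub, exp_nat_mul, exp_neg, exp_pi_mul_I, inv_neg_one]
    ring
  rw [h1, h2, Complex.sin]
  ring_nf
  rw [I_sq]
  ring

theorem circle_term {ε : ℝ} (hε : 0 < ε) (a : ℂ) {z : ℂ} {k : ℕ} (hz : z - 1 + k ≠ 0) :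
    ∫ θ in (-Real.pi)..Real.pi, polarPow ε θ (z - 1) * (a * polarPt ε θ ^ k * I) =
      -(2 * I * sin (Real.pi * z)) * (a * (-1) ^ k * (ε : ℂ) ^ (z - 1 + k) / (z - 1 + k)) := by
  have h1 : ∀ θ : ℝ, polarPow ε θ (z - 1) * (a * polarPt ε θ ^ k * I) =
      a * I * (ε : ℂ) ^ (z - 1 + k) * exp (I * (z - 1 + k) * θ) := fun θ => by
    have := polarPow_mul_polarPt_pow hε θ (z - 1) k
    linear_combination a * I * this
  simp only [h1]
  rw [intervalIntegral.integral_const_mul, integral_exp_mul_complex (mul_ne_zero I_ne_zero hz),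
    exp_I_pi_sub]
  field_simp

/-- Here `Re z > 1` makes `r^(z-2)` integrable at `0`. The terms are those of `circle_term` without
the factor `-2i sin(πz)`. -/
theorem hasSum_ray {ε : ℝ} (hε : 0 < ε) {a : ℕ → ℂ} {h : ℂ → ℂ}
    (hsum : ∀ s : ℂ, ‖s‖ ≤ ε → HasSum (fun k => a k * s ^ k) (h s)) {z : ℂ} (hz : 1 < z.re) :
    HasSum (fun k : ℕ => a k * (-1) ^ k * (ε : ℂ) ^ (z - 1 + k) / (z - 1 + k))
      (∫ r in (0 : ℝ)..ε, (r : ℂ) ^ (z - 2) * h (-r)) := by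
  have hsε : Summable fun k => ‖a k‖ * ε ^ k := by
    have := (hsum ε (by simp [abs_of_pos hε])).summable.norm
    simpa [abs_of_pos hε] using this
  have hint : IntervalIntegrable (fun r : ℝ => (r : ℂ) ^ (z - 2)) volume 0 ε :=
    intervalIntegral.intervalIntegrable_cpow' (by simp; linarith)
  have key : HasSum (fun k : ℕ => ∫ r in (0 : ℝ)..ε, (r : ℂ) ^ (z - 2) * (a k * (-r : ℂ) ^ k))
      (∫ r in (0 : ℝ)..ε, (r : ℂ) ^ (z - 2) * h (-r)) := by
    refine intervalIntegral.hasSum_integral_of_dominated_convergence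
      (fun k r => ‖(r : ℂ) ^ (z - 2)‖ * (‖a k‖ * ε ^ k)) (fun k => ?_) (fun k => ?_) ?_ ?_ ?_
    · exact hint.def'.1.mul (Continuous.aestronglyMeasurable (by fun_prop))
    · refine .of_forall fun r hr => ?_
      rw [uIoc_of_le hε.le] at hr
      rw [norm_mul, norm_mul, norm_pow, norm_neg, norm_real, Real.norm_of_nonneg hr.1.le]
      have := hr.1.le
      gcongr
      exact hr.2
    · exact .of_forall fun r _ => hsε.mul_left _
    · simp only [tsum_mul_left]
      exact hint.norm.mul_const _
    · refine .of_forall fun r hr => ?_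
      rw [uIoc_of_le hε.le] at hr
      exact (hsum _ (by simpa [abs_of_pos hr.1] using hr.2)).mul_left _
  refine key.congr_fun fun k => ?_
  have h1 : ∫ r in (0 : ℝ)..ε, (r : ℂ) ^ (z - 2) * (a k * (-r : ℂ) ^ k) =
      ∫ r in (0 : ℝ)..ε, a k * (-1) ^ k * (r : ℂ) ^ (z - 2 + k) := by
    refine intervalIntegral.integral_congr_ae (.of_forall fun r hr => ?_)
    rw [uIoc_of_le hε.le] at hr
    rw [cpow_add _ _ (by exact_mod_cast hr.1.ne'), cpow_natCast, neg_pow]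
    ring
  have h2 : z - 2 + k + 1 = z - 1 + k := by ring
  have h3 : z - 1 + k ≠ 0 := by
    intro h
    have := congrArg re h
    simp at this
    have : (0 : ℝ) ≤ k := k.cast_nonneg
    linarith
  rw [h1, intervalIntegral.integral_const_mul,
    integral_cpow (.inl (by simp; linarith [k.cast_nonneg (α := ℝ)])), h2, ofReal_zero, zero_cpow h3]
  ring

/-- The two sides have proportional series, term by term. This replaces the usual shrinking of the
circle as `ε → 0`. -/
theorem circle_eq_ray {ε : ℝ} (hε : 0 < ε) {a : ℕ → ℂ} {h : ℂ → ℂ}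
    (hsum : ∀ s : ℂ, ‖s‖ ≤ ε → HasSum (fun k => a k * s ^ k) (h s)) {z : ℂ} (hz : 1 < z.re) :
    ∫ θ in (-Real.pi)..Real.pi, polarPow ε θ (z - 1) * (h (polarPt ε θ) * I) =
      -(2 * I * sin (Real.pi * z)) * ∫ r in (0 : ℝ)..ε, (r : ℂ) ^ (z - 2) * h (-r) := by
  refine (hasSum_circle hε hsum z).unique ?_
  refine ((hasSum_ray hε hsum hz).mul_left _).congr_fun fun k => ?_
  refine circle_term hε _ fun h => ?_
  have := congrArg re h
  simp at this
  linarith [k.cast_nonneg (α := ℝ)]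

/-- The factor `sin π = 0` kills every term with `k ≥ 1`. For `k = 0` the exponent `z - 1 + k`
vanishes, the integrand is constant, and `2πi a_0` remains. -/
theorem circle_at_one {ε : ℝ} (hε : 0 < ε) {a : ℕ → ℂ} {h : ℂ → ℂ}
    (hsum : ∀ s : ℂ, ‖s‖ ≤ ε → HasSum (fun k => a k * s ^ k) (h s)) :
    ∫ θ in (-Real.pi)..Real.pi, polarPow ε θ (1 - 1) * (h (polarPt ε θ) * I) =
      2 * I * Real.pi * h 0 := by
  have h0 : h 0 = a 0 := by
    refine (hsum 0 (by simpa using hε.le)).unique ?_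
    convert hasSum_single (f := fun k => a k * (0 : ℂ) ^ k) 0 (by simp +contextual) using 1
    simp
  refine (hasSum_circle hε hsum 1).unique ?_
  convert hasSum_single (f := fun k : ℕ => ∫ θ in (-Real.pi)..Real.pi,
        polarPow ε θ (1 - 1) * (a k * polarPt ε θ ^ k * I)) 0 (fun k hk => ?_) using 1
  · simp [polarPow, h0]
    ring
  · rw [circle_term hε _ (by simpa using hk)]
    simp

/-! ### Removing the pole of the integrand at the origin -/

theorem differentiable_dslope_exp : Differentiable ℂ (dslope exp 0) := by
  rw [← differentiableOn_univ, Complex.differentiableOn_dslope univ_mem]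
  exact differentiable_exp.differentiableOn

theorem dslope_exp_of_ne_zero {s : ℂ} (hs : s ≠ 0) : dslope exp 0 s = (exp s - 1) / s := by
  rw [dslope_of_ne _ hs, slope_def_field, sub_zero, exp_zero]

/-- The solutions of `e^s = 1` are the multiples of `2πi`; hence the bound `ε < 2π`. -/
theorem exp_ne_one_of_norm_lt {s : ℂ} (hs0 : s ≠ 0) (hs : ‖s‖ < 2 * Real.pi) : exp s ≠ 1 := by
  intro h
  obtain ⟨n, rfl⟩ := exp_eq_one_iff.1 h
  have hn : n ≠ 0 := by rintro rfl; simp at hs0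
  have h1 : (1 : ℝ) ≤ |(n : ℝ)| := by exact_mod_cast Int.one_le_abs hn
  have h2 : ‖(n : ℂ) * (2 * Real.pi * I)‖ = |(n : ℝ)| * (2 * Real.pi) := by
    simp [abs_of_pos Real.pi_pos]
  rw [h2] at hs
  nlinarith [Real.pi_pos]

theorem dslope_exp_ne_zero {s : ℂ} (hs : ‖s‖ < 2 * Real.pi) : dslope exp 0 s ≠ 0 := by
  by_cases hs0 : s = 0
  · simp [hs0]
  · rw [dslope_exp_of_ne_zero hs0]
    exact div_ne_zero (sub_ne_zero.2 (exp_ne_one_of_norm_lt hs0 hs)) hs0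

/-- The function `s e^{N s} p(s) / (1 - e^s)`, with the removable singularity at `0` filled in. -/
def regularPart (N : ℕ) (p : ℂ → ℂ) (s : ℂ) : ℂ := -(exp (N * s) * p s) / dslope exp 0 s

theorem regularPart_zero (N : ℕ) (p : ℂ → ℂ) : regularPart N p 0 = -p 0 := by
  simp [regularPart]

theorem regularPart_of_ne_zero (N : ℕ) (p : ℂ → ℂ) {s : ℂ} (hs : s ≠ 0) :
    regularPart N p s = exp (N * s) * p s / (1 - exp s) * s := by
  rw [regularPart, dslope_exp_of_ne_zero hs, div_div_eq_mul_div, ← neg_sub (exp s), div_neg]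
  ring

theorem differentiableOn_regularPart (N : ℕ) {p : ℂ → ℂ} (hp : Differentiable ℂ p) :
    DifferentiableOn ℂ (regularPart N p) (Metric.ball 0 (2 * Real.pi)) := by
  have h1 := differentiable_dslope_exp
  intro s hs
  refine DifferentiableAt.differentiableWithinAt ?_
  unfold regularPart
  exact DifferentiableAt.div (by fun_prop) (h1 s) (dslope_exp_ne_zero (mem_ball_zero_iff.1 hs))

theorem exists_hasSum_regularPart (N : ℕ) {p : ℂ → ℂ} (hp : Differentiable ℂ p) {ε : ℝ}
    (hε : ε < 2 * Real.pi) : ∃ a : ℕ → ℂ, ∀ s : ℂ, ‖s‖ ≤ ε →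
      HasSum (fun k => a k * s ^ k) (regularPart N p s) := by
  refine ⟨fun k => (k.factorial : ℂ)⁻¹ * iteratedDeriv k (regularPart N p) 0, fun s hs => ?_⟩
  refine (hasSum_taylorSeries_on_ball (differentiableOn_regularPart N hp)
    (mem_ball_zero_iff.2 (hs.trans_lt hε))).congr_fun fun k => ?_
  simp only [smul_eq_mul, sub_zero]
  ring

/-! ### The Hankel contour integral -/

/-- The integrand `s^{z-1} e^{N s} p(s) / (1 - e^s)` at `s = r e^{iθ}`. -/
def hankelIntegrand (N : ℕ) (p : ℂ → ℂ) (z : ℂ) (r θ : ℝ) : ℂ :=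
  polarPow r θ (z - 1) * exp (N * polarPt r θ) * p (polarPt r θ) / (1 - exp (polarPt r θ))

theorem hankelIntegrand_pi (N : ℕ) (p : ℂ → ℂ) (z : ℂ) (r : ℝ) :
    hankelIntegrand N p z r Real.pi =
      exp (I * Real.pi * (z - 1)) * ((r : ℂ) ^ (z - 1) * kernel N p r) := by
  rw [hankelIntegrand, polarPt_pi, polarPow, kernel]
  ring

theorem hankelIntegrand_neg_pi (N : ℕ) (p : ℂ → ℂ) (z : ℂ) (r : ℝ) :
    hankelIntegrand N p z r (-Real.pi) =
      exp (I * (-Real.pi : ℝ) * (z - 1)) * ((r : ℂ) ^ (z - 1) * kernel N p r) := by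
  rw [hankelIntegrand, polarPt_neg_pi, polarPow, kernel]
  ring

/-- On the circle `ds = i s dθ`, and the factor `s` cancels the pole of `1 / (1 - e^s)` at `0`. -/
theorem hankelIntegrand_circle {ε : ℝ} (hε : 0 < ε) (N : ℕ) (p : ℂ → ℂ) (z : ℂ) (θ : ℝ) :
    hankelIntegrand N p z ε θ * (I * polarPt ε θ) =
      polarPow ε θ (z - 1) * (regularPart N p (polarPt ε θ) * I) := by
  have h : polarPt ε θ ≠ 0 := by
    rw [← norm_pos_iff, norm_polarPt hε.le]
    exact hε
  rw [regularPart_of_ne_zero N p h, hankelIntegrand]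
  ring

section
variable {N : ℕ} {p : ℂ → ℂ} {C A ε : ℝ}

theorem hankelIntegrable_hankelIntegrand (hp : Differentiable ℂ p) (hAN : A < N)
    (hb : ∀ s, ‖p s‖ ≤ C * Real.exp (A * ‖s‖)) (hε : 0 < ε) (hε2 : ε < 2 * Real.pi) (z : ℂ) :
    HankelIntegrable ε (hankelIntegrand N p z) := by
  have h := integrableOn_Ioi_cpow_mul_kernel hε hp hAN hb z
  refine ⟨?_, ?_, ?_⟩
  · simp only [hankelIntegrand_neg_pi]
    exact h.const_mul _
  · have h1 := continuous_polarPt ε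
    have h2 := hp.continuous
    have h3 : Continuous fun θ => polarPow ε θ (z - 1) := by
      simp only [polarPow_eq_exp hε]; fun_prop
    refine Continuous.intervalIntegrable ?_ _ _
    unfold hankelIntegrand
    refine Continuous.div (by fun_prop) (by fun_prop) fun θ => ?_
    have hn := norm_polarPt hε.le θ
    refine sub_ne_zero.2 (exp_ne_one_of_norm_lt ?_ (hn.trans_lt hε2)).symm
    rw [← norm_pos_iff, hn]
    exact hε
  · simp only [hankelIntegrand_pi]
    exact h.const_mul _

/-- On the two rays `s^(z-1) ds` has phases `e^(iπz)` and `e^(-iπz)`. As the rays are run in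
opposite directions, these subtract to `2i sin(πz)`. -/
theorem hankelIntegral_hankelIntegrand (hε : 0 < ε) (N : ℕ) (p : ℂ → ℂ) (z : ℂ) :
    hankelIntegral ε (hankelIntegrand N p z) =
      2 * I * sin (Real.pi * z) * mellin (tailKernel ε N p) z +
        ∫ θ in (-Real.pi)..Real.pi, polarPow ε θ (z - 1) * (regularPart N p (polarPt ε θ) * I) := by
  simp only [hankelIntegral, hankelIntegrand_circle hε, hankelIntegrand_pi, hankelIntegrand_neg_pi,
    integral_mul_const, integral_const_mul, ← mellin_tailKernel hε]
  have h1 : exp (I * Real.pi * (z - 1)) * exp (I * Real.pi) = exp (Real.pi * z * I) := by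
    rw [← exp_add]; ring_nf
  have h2 : exp (I * (-Real.pi : ℝ) * (z - 1)) * exp (I * (-Real.pi : ℝ)) =
      exp (-(Real.pi * z) * I) := by
    rw [← exp_add]; push_cast; ring_nf
  have h3 : 2 * I * sin (Real.pi * z) = exp (Real.pi * z * I) - exp (-(Real.pi * z) * I) := by
    rw [Complex.sin]
    ring_nf
    rw [I_sq]
    ring
  rw [h3, ← h1, ← h2]
  ring

/-- The normalized contour integral `1/(2iπ) ∫_μ s^{z-1} e^{N s} p(s) / (1 - e^s) ds`. -/
def hankel (ε : ℝ) (N : ℕ) (p : ℂ → ℂ) (z : ℂ) : ℂ :=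
  1 / (2 * I * Real.pi) * hankelIntegral ε (hankelIntegrand N p z)

theorem differentiable_hankel (hp : Differentiable ℂ p) (hAN : A < N)
    (hb : ∀ s, ‖p s‖ ≤ C * Real.exp (A * ‖s‖)) (hε : 0 < ε) (hε2 : ε < 2 * Real.pi) :
    Differentiable ℂ (hankel ε N p) := by
  have h1 := differentiable_mellin_tailKernel hε hp hAN hb
  have h2 : Continuous fun θ => regularPart N p (polarPt ε θ) * I := by
    refine Continuous.mul ?_ continuous_const
    exact (differentiableOn_regularPart N hp).continuousOn.comp_continuous (continuous_polarPt ε)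
      fun θ => mem_ball_zero_iff.2 ((norm_polarPt hε.le θ).trans_lt hε2)
  have h3 := differentiable_circle hε h2
  unfold hankel
  simp only [hankelIntegral_hankelIntegrand hε]
  fun_prop

theorem hankel_eq_mellin (hp : Differentiable ℂ p) (hC : 0 < C) (hAN : A < N)
    (hb : ∀ s, ‖p s‖ ≤ C * Real.exp (A * ‖s‖)) (hε : 0 < ε) (hε2 : ε < 2 * Real.pi) {z : ℂ}
    (hz : 1 < z.re) :
    hankel ε N p z = sin (Real.pi * z) / Real.pi * mellin (kernel N p) z := by
  obtain ⟨a, ha⟩ := exists_hasSum_regularPart N hp hε2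
  have hray : ∫ r in (0 : ℝ)..ε, (r : ℂ) ^ (z - 2) * regularPart N p (-r) =
      -∫ r in (0 : ℝ)..ε, (r : ℂ) ^ (z - 1) * kernel N p r := by
    rw [← intervalIntegral.integral_neg]
    refine intervalIntegral.integral_congr_ae (.of_forall fun r hr => ?_)
    rw [uIoc_of_le hε.le] at hr
    have hr0 : (r : ℂ) ≠ 0 := by exact_mod_cast hr.1.ne'
    rw [regularPart_of_ne_zero N p (neg_ne_zero.2 hr0), show z - 1 = z - 2 + 1 by ring,
      cpow_add _ _ hr0, cpow_one, kernel]
    ring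
  have hpi : (Real.pi : ℂ) ≠ 0 := by exact_mod_cast Real.pi_ne_zero
  rw [hankel, hankelIntegral_hankelIntegrand hε, circle_eq_ray hε ha hz, hray,
    mellin_kernel_eq_add hε hp hC hAN hb hz]
  field_simp
  ring

theorem hankel_one (hp : Differentiable ℂ p) (hε : 0 < ε) (hε2 : ε < 2 * Real.pi) :
    hankel ε N p 1 = -p 0 := by
  obtain ⟨a, ha⟩ := exists_hasSum_regularPart N hp hε2
  have hpi : (Real.pi : ℂ) ≠ 0 := by exact_mod_cast Real.pi_ne_zero
  rw [hankel, hankelIntegral_hankelIntegrand hε, circle_at_one hε ha, regularPart_zero, mul_one,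
    sin_pi]
  field_simp
  ring

/-- Both functions are entire and agree on `Re z > 1`, where the Mellin formula does not involve the
radius; the identity theorem does the rest. -/
theorem hankel_eq_hankel (hp : Differentiable ℂ p) (hC : 0 < C) (hAN : A < N)
    (hb : ∀ s, ‖p s‖ ≤ C * Real.exp (A * ‖s‖)) {ε ε' : ℝ} (hε : 0 < ε) (hε2 : ε < 2 * Real.pi)
    (hε' : 0 < ε') (hε2' : ε' < 2 * Real.pi) : hankel ε N p = hankel ε' N p := by
  have h1 := differentiable_hankel hp hAN hb hε hε2
  have h2 := differentiable_hankel hp hAN hb hε' hε2'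
  refine AnalyticOnNhd.eq_of_eventuallyEq (z₀ := 2)
    (fun z _ => h1.analyticAt z) (fun z _ => h2.analyticAt z) ?_
  filter_upwards [(isOpen_lt continuous_const continuous_re).mem_nhds
    (show (1 : ℝ) < (2 : ℂ).re by norm_num)] with z hz
  rw [hankel_eq_mellin hp hC hAN hb hε hε2 hz, hankel_eq_mellin hp hC hAN hb hε' hε2' hz]

end

/-! ### The integral representation of `Γ(z) L(z,f)` -/

theorem Gamma_mul_binom_neg {z : ℂ} (hz : 0 < z.re) (k : ℕ) :
    Gamma z * binom (-z) k = (-1) ^ k * Gamma (z + k) / k.factorial := by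
  induction k with
  | zero => simp [binom]
  | succ k ih =>
    have h0 : z + k ≠ 0 := by
      intro h
      have := congrArg re h
      simp at this
      linarith [k.cast_nonneg (α := ℝ)]
    have h1 : ((k.factorial : ℕ) : ℂ) ≠ 0 := by exact_mod_cast k.factorial_ne_zero
    have h2 : (k : ℂ) + 1 ≠ 0 := by exact_mod_cast k.succ_ne_zero
    have h3 : z + ((k + 1 : ℕ) : ℂ) = z + k + 1 := by push_cast; ring
    rw [binom_succ, mul_left_comm, ih, h3, Gamma_add_one _ h0, Nat.factorial_succ, pow_succ]
    push_cast
    field_simp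
    ring

theorem norm_cpow_mul_exp {t : ℝ} (ht : 0 < t) (z : ℂ) (c : ℝ) :
    ‖(t : ℂ) ^ (z - 1) * exp (-(c * t : ℂ))‖ = t ^ (z.re - 1) * Real.exp (-(c * t)) := by
  rw [norm_mul, norm_cpow_eq_rpow_re_of_pos ht, norm_exp]
  simp

theorem aestronglyMeasurable_cpow_mul_exp (z : ℂ) (c : ℝ) {g : ℝ → ℂ} (hg : Continuous g)
    (μ : Measure ℝ) :
    AEStronglyMeasurable (fun t : ℝ => (t : ℂ) ^ (z - 1) * exp (-(c * t : ℂ)) * g t) μ := by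
  have := hg.measurable
  exact Measurable.aestronglyMeasurable (by fun_prop)

/-- Termwise, `∫ t^(z+k-1) e^(-nt) dt = Γ(z+k) n^(-z-k)`, and `Gamma_mul_binom_neg` turns
`Γ(z+k)/k!` into a binomial coefficient; its sign cancels that of `(-t)^k`. The sum of the majorants
is `C t^(Re z - 1) e^(-(n-A)t)`, integrable because `A < n`. -/
theorem Gamma_mul_gpow {f : ℝ → ℂ} {C A : ℝ} (hρ : rho f ≠ 0)
    (hP : ∀ k, ‖pNum f k‖ ≤ C * A ^ k) (hA : A < nf f)
    {n : ℕ} (hn : nf f ≤ n) {z : ℂ} (hz : 0 < z.re) :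
    Gamma z * gpow f n (-z) =
      ∫ t in Ioi (0 : ℝ), (t : ℂ) ^ (z - 1) * exp (-((n : ℝ) * t : ℂ)) * pExt f (-t) := by
  have hn0 : 0 < n := (Nat.succ_pos _).trans_le hn
  have hn1 : (0 : ℝ) < n := by exact_mod_cast hn0
  have hn2 : (n : ℂ) ≠ 0 := by exact_mod_cast hn0.ne'
  have hAn : A < n := hA.trans_le (by exact_mod_cast hn)
  have key : HasSum (fun k : ℕ => ∫ t in Ioi (0 : ℝ), (t : ℂ) ^ (z - 1) * exp (-((n : ℝ) * t : ℂ)) *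
        (pNum f k / (k.factorial : ℂ) * (-t) ^ k))
      (∫ t in Ioi (0 : ℝ), (t : ℂ) ^ (z - 1) * exp (-((n : ℝ) * t : ℂ)) * pExt f (-t)) := by
    refine hasSum_integral_of_dominated_convergence
      (fun k t => t ^ (z.re - 1) * Real.exp (-(n * t)) * (C * ((A * t) ^ k / k.factorial)))
      (fun k => aestronglyMeasurable_cpow_mul_exp z n (by fun_prop) _) (fun k => ?_) ?_ ?_ ?_
    · refine ae_restrict_of_forall_mem measurableSet_Ioi fun t ht => ?_
      rw [norm_mul, norm_cpow_mul_exp ht]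
      have := norm_pExt_term_le hP (r := t) (s := -t) (by simp [abs_of_pos (mem_Ioi.1 ht)]) k
      have h0 : 0 ≤ t ^ (z.re - 1) := Real.rpow_nonneg (mem_Ioi.1 ht).le _
      gcongr
    · exact .of_forall fun t => (summable_exp_majorant C A t).mul_left _
    · simp only [tsum_mul_left]
      have h := (integrableOn_rpow_mul_exp_neg_mul_rpow (s := z.re - 1) (p := 1) (b := n - A)
        (by linarith) one_pos (by linarith)).const_mul C
      refine IntegrableOn.congr_fun h (fun t _ => ?_) measurableSet_Ioi
      have := tsum_exp_majorant C A t
      rw [tsum_mul_left] at this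
      simp only [this, Real.rpow_one]
      rw [show -(n - A) * t = -(n * t) + A * t by ring, Real.exp_add]
      ring
    · exact .of_forall fun t => (hasSum_pExt hP _).mul_left _
  have hs := (summable_norm_gpowTerm hρ hn (-z)).of_norm.hasSum.mul_left (Gamma z * (n : ℂ) ^ (-z))
  rw [gpow, ← mul_assoc]
  refine hs.unique (key.congr_fun fun k => ?_)
  have h1 : ∫ t in Ioi (0 : ℝ), (t : ℂ) ^ (z - 1) * exp (-((n : ℝ) * t : ℂ)) *
        (pNum f k / (k.factorial : ℂ) * (-t) ^ k) =
      ∫ t in Ioi (0 : ℝ), pNum f k / (k.factorial : ℂ) * (-1) ^ k *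
        ((t : ℂ) ^ (z + k - 1) * exp (-((n : ℝ) * t : ℂ))) := by
    refine setIntegral_congr_fun measurableSet_Ioi fun t ht => ?_
    have ht0 : (t : ℂ) ≠ 0 := by exact_mod_cast (mem_Ioi.1 ht).ne'
    rw [show z + k - 1 = z - 1 + k by ring, cpow_add _ _ ht0, cpow_natCast, neg_pow]
    ring
  have h2 : (1 / ((n : ℝ) : ℂ)) ^ (z + k) = (n : ℂ) ^ (-z) * (1 / n) ^ k := by
    rw [ofReal_natCast, cpow_add _ _ (one_div_ne_zero hn2), cpow_natCast, one_div, inv_cpow,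
      cpow_neg]
    rw [natCast_arg]
    exact Real.pi_ne_zero.symm
  rw [h1, integral_const_mul, integral_cpow_mul_exp_neg_mul_Ioi
    (by simp; linarith [k.cast_nonneg (α := ℝ)]) hn1, h2, gpowTerm]
  linear_combination ((n : ℂ) ^ (-z) * pNum f k * (1 / n) ^ k) * (Gamma_mul_binom_neg hz k)

theorem Gamma_mul_LSum {f : ℝ → ℂ} {C A : ℝ} (hρ : rho f ≠ 0) (hC : 0 < C)
    (hA0 : 0 < A) (hP : ∀ k, ‖pNum f k‖ ≤ C * A ^ k) (hA : A < nf f) {z : ℂ} (hz : 1 < z.re) :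
    Gamma z * LSum f z = mellin (kernel (nf f) (pExt f)) z := by
  have hpc := (differentiable_pExt hρ).continuous
  have hs := (summable_norm_gpow hρ hz).of_norm.hasSum.mul_left (Gamma z)
  refine hs.unique ?_
  simp only [fun m => Gamma_mul_gpow hρ hP hA (Nat.le_add_right (nf f) m) (zero_lt_one.trans hz)]
  refine hasSum_integral_of_dominated_convergence
    (fun m t => t ^ (z.re - 1) * (C * Real.exp (-(nf f - A) * t)) * Real.exp (-t) ^ m)
    (fun m => aestronglyMeasurable_cpow_mul_exp z _ (by fun_prop) _) (fun m => ?_) ?_ ?_ ?_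
  · refine ae_restrict_of_forall_mem measurableSet_Ioi fun t ht => ?_
    rw [norm_mul, norm_cpow_mul_exp ht]
    have hb := norm_pExt_le hP (-t)
    rw [norm_neg, norm_real, Real.norm_of_nonneg (mem_Ioi.1 ht).le] at hb
    have h0 : 0 ≤ t ^ (z.re - 1) := Real.rpow_nonneg (mem_Ioi.1 ht).le _
    calc _ ≤ t ^ (z.re - 1) * Real.exp (-(((nf f + m : ℕ) : ℝ) * t)) * (C * Real.exp (A * t)) := by
          gcongr
      _ = _ := by
          rw [← Real.exp_nat_mul, show -(((nf f + m : ℕ) : ℝ) * t) =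
            -(nf f - A) * t + m * (-t) - A * t by push_cast; ring, Real.exp_sub, Real.exp_add]
          field_simp
  · refine ae_restrict_of_forall_mem measurableSet_Ioi fun t ht => ?_
    have := one_sub_exp_neg_pos (mem_Ioi.1 ht)
    exact (summable_geometric_of_lt_one (Real.exp_pos _).le (by linarith)).mul_left _
  -- The summed majorant is the norm of the Mellin integrand for `C e^(-As)` in place of `p_f`, so
  -- the convergence already proved for kernels applies to it.
  · have hq : Differentiable ℂ fun s => (C : ℂ) * exp (-(A * s)) := by fun_prop
    have hb : ∀ s : ℂ, ‖(C : ℂ) * exp (-(A * s))‖ ≤ C * Real.exp (A * ‖s‖) := fun s => by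
      have h1 : -s.re ≤ ‖s‖ := (neg_le_abs _).trans (abs_re_le_norm s)
      rw [norm_mul, norm_real, Real.norm_of_nonneg hC.le, norm_exp, neg_re, re_ofReal_mul,
        ← mul_neg]
      gcongr
    refine IntegrableOn.congr_fun (mellinConvergent_kernel hq hC hA hb hz).norm (fun t ht => ?_)
      measurableSet_Ioi
    have ht0 := mem_Ioi.1 ht
    have h1 := one_sub_exp_neg_pos ht0
    have h2 : ‖exp (nf f * (-t : ℂ))‖ = Real.exp (-(nf f * t)) := by
      rw [norm_exp]; simp
    have h3 : ‖exp (-(A * -t : ℂ))‖ = Real.exp (A * t) := by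
      rw [norm_exp]; simp
    rw [tsum_mul_left, tsum_geometric_of_lt_one (Real.exp_pos _).le (by linarith), norm_smul,
      norm_cpow_eq_rpow_re_of_pos ht0, kernel, norm_div, norm_one_sub_exp_neg ht0, norm_mul,
      norm_mul, h2, h3, norm_real, Real.norm_of_nonneg hC.le,
      show -(nf f - A) * t = -(nf f * t) + A * t by ring, Real.exp_add, sub_re, one_re]
    ring
  · refine ae_restrict_of_forall_mem measurableSet_Ioi fun t ht => ?_
    have h1 := one_sub_exp_neg_pos (mem_Ioi.1 ht)
    have h2 : ‖exp (-t : ℂ)‖ < 1 := by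
      rw [norm_exp]; simpa using mem_Ioi.1 ht
    have := (hasSum_geometric_of_norm_lt_one h2).mul_left
      ((t : ℂ) ^ (z - 1) * (exp (nf f * (-t : ℂ)) * pExt f (-t)))
    rw [kernel, smul_eq_mul, div_eq_mul_inv, ← mul_assoc]
    refine this.congr_fun fun m => ?_
    rw [← exp_nat_mul, show -(((nf f + m : ℕ) : ℝ) * t : ℂ) = nf f * (-t : ℂ) + m * (-t : ℂ) by
      push_cast; ring, exp_add]
    ring

/-! ### Analytic continuation and the point `1` -/

theorem Gamma_one_sub_mul_sin (z : ℂ) (hz : ∀ m : ℕ, z ≠ (m : ℂ) + 1) (hz0 : 0 < z.re) :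
    Gamma (1 - z) * (sin (Real.pi * z) / Real.pi) = (Gamma z)⁻¹ := by
  have h := Gamma_mul_Gamma_one_sub z
  have h1 : Gamma z ≠ 0 := Gamma_ne_zero_of_re_pos hz0
  have h2 : Gamma (1 - z) ≠ 0 := Gamma_ne_zero fun m hm => hz m (by linear_combination -hm)
  have hpi : (Real.pi : ℂ) ≠ 0 := by exact_mod_cast Real.pi_ne_zero
  -- If the sine were `0`, the quotient in the reflection formula would be `0` by the convention `x
  -- / 0 = 0`, while both Gamma factors are nonzero.
  have h3 : sin (Real.pi * z) ≠ 0 := fun h0 => by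
    rw [h0, div_zero] at h
    exact mul_ne_zero h1 h2 h
  rw [eq_div_iff h3] at h
  rw [mul_div_assoc', div_eq_iff hpi, inv_mul_eq_div, eq_div_iff h1]
  linear_combination h

/-- Isolates the pole at `1`: the numerator `Γ(2 - w)` is analytic for `Re w < 2`. -/
theorem Gamma_one_sub_eq {w : ℂ} (hw : w ≠ 1) : Gamma (1 - w) = -Gamma (2 - w) / (w - 1) := by
  have h1 : 1 - w ≠ 0 := sub_ne_zero.2 hw.symm
  have h2 : w - 1 ≠ 0 := sub_ne_zero.2 hw
  rw [show 2 - w = 1 - w + 1 by ring, Gamma_add_one _ h1]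
  field_simp
  ring

theorem differentiableAt_Gamma_two_sub {w : ℂ} (hw : w.re < 2) :
    DifferentiableAt ℂ (fun w => Gamma (2 - w)) w := by
  refine DifferentiableAt.comp (g := Gamma) w (differentiableAt_Gamma _ fun m hm => ?_)
    (by fun_prop)
  have := congrArg re hm
  simp at this
  linarith [m.cast_nonneg (α := ℝ)]

/-- The analytic continuation, built from the Mellin transform `M` (for `Re z > 1`) and
the contour integral `J`. The value at `1` is the one that removes the singularity when there is
no pole. -/
def continuation (M J : ℂ → ℂ) (z : ℂ) : ℂ :=
  if z = 1 then deriv (fun w => -Gamma (2 - w) * J w) 1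
  else if 1 < z.re then M z / Gamma z else Gamma (1 - z) * J z

section
variable {M J : ℂ → ℂ}

theorem continuation_of_one_lt_re {z : ℂ} (hz : 1 < z.re) :
    continuation M J z = M z / Gamma z := by
  rw [continuation, if_neg (by rintro rfl; simp at hz), if_pos hz]

theorem continuation_eq (hMJ : ∀ z : ℂ, 1 < z.re → J z = sin (Real.pi * z) / Real.pi * M z)
    {z : ℂ} (hz : ∀ m : ℕ, z ≠ (m : ℂ) + 1) : continuation M J z = Gamma (1 - z) * J z := by
  have h1 : z ≠ 1 := by simpa using hz 0
  rw [continuation, if_neg h1]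
  split_ifs with h
  · rw [hMJ z h, ← mul_assoc, Gamma_one_sub_mul_sin z hz (zero_lt_one.trans h), div_eq_inv_mul]
  · rfl

theorem continuation_eq_of_re_lt_two
    (hMJ : ∀ z : ℂ, 1 < z.re → J z = sin (Real.pi * z) / Real.pi * M z) {z : ℂ} (hz : z.re < 2)
    (hz1 : z ≠ 1) : continuation M J z = -Gamma (2 - z) * J z / (z - 1) := by
  rw [continuation_eq hMJ, Gamma_one_sub_eq hz1]
  · ring
  · rintro m rfl
    have hm : m ≠ 0 := by rintro rfl; simp at hz1
    have : (1 : ℝ) ≤ m := by exact_mod_cast Nat.one_le_iff_ne_zero.2 hm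
    simp at hz
    linarith

/-- The half-planes `Re z > 1` and `Re z < 2` cover the plane. On the first `M/Γ` is analytic, on
the second only the denominator `z - 1` can vanish. -/
theorem differentiableAt_continuation (hM : ∀ z : ℂ, 1 < z.re → DifferentiableAt ℂ M z)
    (hJ : Differentiable ℂ J) (hMJ : ∀ z : ℂ, 1 < z.re → J z = sin (Real.pi * z) / Real.pi * M z)
    {z : ℂ} (hz1 : z ≠ 1) : DifferentiableAt ℂ (continuation M J) z := by
  rcases lt_or_ge 1 z.re with h | h
  · have hev : continuation M J =ᶠ[𝓝 z] fun w => M w / Gamma w := by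
      filter_upwards [(isOpen_lt continuous_const continuous_re).mem_nhds h] with w hw
      exact continuation_of_one_lt_re hw
    refine DifferentiableAt.congr_of_eventuallyEq ?_ hev
    refine (hM z h).div (differentiableAt_Gamma z fun m hm => ?_)
      (Gamma_ne_zero_of_re_pos (zero_lt_one.trans h))
    have := congrArg re hm
    simp at this
    linarith [m.cast_nonneg (α := ℝ)]
  · have h2 : z.re < 2 := by linarith
    have hev : continuation M J =ᶠ[𝓝 z] fun w => -Gamma (2 - w) * J w / (w - 1) := by
      filter_upwards [(isOpen_lt continuous_re continuous_const).mem_nhds h2,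
        isOpen_ne.mem_nhds hz1] with w hw hw1
      exact continuation_eq_of_re_lt_two hMJ hw hw1
    refine DifferentiableAt.congr_of_eventuallyEq ?_ hev
    exact ((differentiableAt_Gamma_two_sub h2).neg.mul (hJ z)).div (by fun_prop)
      (sub_ne_zero.2 hz1)

theorem differentiable_continuation (hM : ∀ z : ℂ, 1 < z.re → DifferentiableAt ℂ M z)
    (hJ : Differentiable ℂ J) (hMJ : ∀ z : ℂ, 1 < z.re → J z = sin (Real.pi * z) / Real.pi * M z)
    (hJ1 : J 1 = 0) : Differentiable ℂ (continuation M J) := by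
  intro z
  by_cases hz1 : z = 1
  · subst hz1
    set U : Set ℂ := {w | w.re < 2}
    have hU : IsOpen U := isOpen_lt continuous_re continuous_const
    have hU1 : U ∈ 𝓝 (1 : ℂ) := hU.mem_nhds (by simp [U])
    have hE : DifferentiableOn ℂ (fun w => -Gamma (2 - w) * J w) U := fun w hw =>
      ((differentiableAt_Gamma_two_sub hw).neg.mul (hJ w)).differentiableWithinAt
    -- As `J 1 = 0`, the quotient by `w - 1` is a difference quotient at `1`, and its value there is
    -- the derivative chosen in `continuation`.
    have hD := ((Complex.differentiableOn_dslope hU1).2 hE).differentiableAt hU1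
    refine hD.congr_of_eventuallyEq ?_
    filter_upwards [hU1] with w hw
    by_cases hw1 : w = 1
    · subst hw1
      rw [dslope_same, continuation, if_pos rfl]
    · rw [continuation_eq_of_re_lt_two hMJ hw hw1, dslope_of_ne _ hw1, slope_def_field, hJ1]
      simp
  · exact differentiableAt_continuation hM hJ hMJ hz1

theorem tendsto_sub_one_mul_continuation (hJ : Differentiable ℂ J)
    (hMJ : ∀ z : ℂ, 1 < z.re → J z = sin (Real.pi * z) / Real.pi * M z) :
    Tendsto (fun z => (z - 1) * continuation M J z) (𝓝[≠] 1) (𝓝 (-J 1)) := by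
  have hc : ContinuousAt (fun w => -Gamma (2 - w) * J w) 1 :=
    ((differentiableAt_Gamma_two_sub (by simp)).neg.mul (hJ 1)).continuousAt
  have h1 : -Gamma (2 - 1) * J 1 = -J 1 := by norm_num
  have ht := hc.tendsto
  simp only [h1] at ht
  refine (ht.mono_left nhdsWithin_le_nhds).congr' ?_
  filter_upwards [nhdsWithin_le_nhds ((isOpen_lt continuous_re continuous_const).mem_nhds
    (show (1 : ℂ).re < 2 by simp)), self_mem_nhdsWithin] with w hw hw1
  rw [continuation_eq_of_re_lt_two hMJ hw hw1, mul_div_cancel₀ _ (sub_ne_zero.2 hw1)]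

theorem meromorphicOrderAt_continuation (hJ : Differentiable ℂ J)
    (hMJ : ∀ z : ℂ, 1 < z.re → J z = sin (Real.pi * z) / Real.pi * M z) (hJ1 : J 1 ≠ 0) :
    meromorphicOrderAt (continuation M J) 1 = -1 := by
  set E : ℂ → ℂ := fun w => -Gamma (2 - w) * J w with hEdef
  have hU : {w : ℂ | w.re < 2} ∈ 𝓝 (1 : ℂ) :=
    (isOpen_lt continuous_re continuous_const).mem_nhds (by simp)
  have hE : AnalyticAt ℂ E 1 := by
    refine DifferentiableOn.analyticAt (s := {w : ℂ | w.re < 2}) (fun w hw => ?_) hU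
    exact ((differentiableAt_Gamma_two_sub hw).neg.mul (hJ w)).differentiableWithinAt
  have hE1 : E 1 ≠ 0 := by
    simp only [hEdef]
    norm_num [hJ1]
  have hev : continuation M J =ᶠ[𝓝[≠] 1] fun w => (w - 1) ^ (-1 : ℤ) • E w := by
    filter_upwards [nhdsWithin_le_nhds hU, self_mem_nhdsWithin] with w hw hw1
    rw [continuation_eq_of_re_lt_two hMJ hw hw1, zpow_neg_one, smul_eq_mul, div_eq_inv_mul]
  have hmer : MeromorphicAt (continuation M J) 1 := by
    refine MeromorphicAt.congr ?_ hev.symm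
    have h1 : AnalyticAt ℂ (fun w : ℂ => w - 1) 1 := by fun_prop
    exact (h1.meromorphicAt.zpow _).smul hE.meromorphicAt
  exact (meromorphicOrderAt_eq_int_iff hmer).2 ⟨E, hE, hE1, hev⟩

/-- The integers other than `z` form a closed set in `ℂ`, so a neighbourhood of `z` avoids them. -/
theorem eventually_ne_natCast_add_one (z : ℂ) : ∀ᶠ w in 𝓝[≠] z, ∀ m : ℕ, w ≠ (m : ℂ) + 1 := by
  have hcl : IsClosed (((↑) : ℤ → ℂ) '' {n : ℤ | (n : ℂ) ≠ z}) :=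
    Complex.isClosedEmbedding_intCast.isClosedMap _ (isClosed_discrete _)
  have hz : z ∉ ((↑) : ℤ → ℂ) '' {n : ℤ | (n : ℂ) ≠ z} := by
    rintro ⟨n, hn, rfl⟩
    exact hn rfl
  filter_upwards [nhdsWithin_le_nhds (hcl.isOpen_compl.mem_nhds hz), self_mem_nhdsWithin]
    with w hw hwz m hm
  have hcast : ((m + 1 : ℤ) : ℂ) = w := by rw [hm]; push_cast; rfl
  refine hw ⟨m + 1, ?_, hcast⟩
  rw [mem_ofPred_eq, hcast]
  exact hwz

theorem tendsto_Gamma_one_sub_mul (hM : ∀ z : ℂ, 1 < z.re → DifferentiableAt ℂ M z)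
    (hJ : Differentiable ℂ J) (hMJ : ∀ z : ℂ, 1 < z.re → J z = sin (Real.pi * z) / Real.pi * M z)
    {z : ℂ} (hz1 : z ≠ 1) :
    Tendsto (fun w => Gamma (1 - w) * J w) (𝓝[≠] z) (𝓝 (continuation M J z)) := by
  refine ((differentiableAt_continuation hM hJ hMJ hz1).continuousAt.tendsto.mono_left
    nhdsWithin_le_nhds).congr' ?_
  filter_upwards [eventually_ne_natCast_add_one z] with w hw
  exact continuation_eq hMJ hw

end

end LCFunction

end

theorem theorem5p4 (f : ℝ → ℂ) (hf : AnalyticAt ℝ f 0) (hρ : LCFunction.rho f ≠ 0) :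
    -- the series defining `n^{(z,f)}`, `n ≥ n_f`, converge, and so does the series `L(z,f)`
    (∀ (n : ℕ) (z : ℂ), LCFunction.nf f ≤ n →
      Summable (fun k : ℕ => ‖LCFunction.gpowTerm f (n : ℂ) z k‖)) ∧
    (∀ z : ℂ, 1 < z.re →
      Summable (fun m : ℕ => ‖LCFunction.gpow f ((LCFunction.nf f + m : ℕ) : ℂ) (-z)‖)) ∧
    -- the contour integral converges
    (∀ ε : ℝ, 0 < ε → ε < 2 * Real.pi → ∀ z : ℂ,
      LCFunction.HankelIntegrable ε (LCFunction.integrand f z)) ∧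
    -- the analytic continuation `L` of `L(z,f)`
    ∃ L : ℂ → ℂ,
      (∀ z : ℂ, 1 < z.re → L z = LCFunction.LSum f z) ∧
      AnalyticOnNhd ℂ L {1}ᶜ ∧
      (f 0 ≠ 0 → meromorphicOrderAt L 1 = -1 ∧
        Filter.Tendsto (fun z => (z - 1) * L z) (𝓝[≠] 1) (𝓝 (f 0))) ∧
      (f 0 = 0 → Differentiable ℂ L) ∧
      (∀ ε : ℝ, 0 < ε → ε < 2 * Real.pi → ∀ z : ℂ, z ≠ 1 →
        -- the formula, literally away from the poles `1, 2, 3, …` of `Γ(1 - z)`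
        ((∀ m : ℕ, z ≠ (m : ℂ) + 1) →
          L z = Complex.Gamma (1 - z) * LCFunction.IInt ε f z) ∧
        -- and through the removable singularity at `2, 3, …`
        Filter.Tendsto (fun w => Complex.Gamma (1 - w) * LCFunction.IInt ε f w)
          (𝓝[≠] z) (𝓝 (L z))) := by
  obtain ⟨C, A, hC, hA, hAn, hP⟩ := LCFunction.exists_norm_pNum_le hρ
  have hp := LCFunction.differentiable_pExt hρ
  have hb := LCFunction.norm_pExt_le hP
  have hpi := Real.pi_gt_three
  have hone : (1 : ℝ) < 2 * Real.pi := by linarith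
  set M := mellin (LCFunction.kernel (LCFunction.nf f) (LCFunction.pExt f))
  -- The radius `1` is an arbitrary choice in `(0, 2π)`; `hI` transfers the results to every other
  -- radius.
  set J := LCFunction.hankel 1 (LCFunction.nf f) (LCFunction.pExt f)
  have hM : ∀ z : ℂ, 1 < z.re → DifferentiableAt ℂ M z := fun z hz =>
    LCFunction.differentiableAt_mellin_kernel hp hC hAn hb hz
  have hJ : Differentiable ℂ J := LCFunction.differentiable_hankel hp hAn hb one_pos hone
  have hMJ : ∀ z : ℂ, 1 < z.re → J z = Complex.sin (Real.pi * z) / Real.pi * M z := fun z hz =>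
    LCFunction.hankel_eq_mellin hp hC hAn hb one_pos hone hz
  have hJ1 : J 1 = -f 0 := by
    rw [← LCFunction.pExt_zero f]
    exact LCFunction.hankel_one hp one_pos hone
  have hI : ∀ ε : ℝ, 0 < ε → ε < 2 * Real.pi → LCFunction.IInt ε f = J := fun ε hε hε2 =>
    LCFunction.hankel_eq_hankel hp hC hAn hb hε hε2 one_pos hone
  refine ⟨fun n z hn => LCFunction.summable_norm_gpowTerm hρ hn z,
    fun z hz => LCFunction.summable_norm_gpow hρ hz,
    fun ε hε hε2 z => LCFunction.hankelIntegrable_hankelIntegrand hp hAn hb hε hε2 z,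
    LCFunction.continuation M J, fun z hz => ?_, ?_, fun h0 => ⟨?_, ?_⟩, fun h0 => ?_,
    fun ε hε hε2 z hz => ?_⟩
  · rw [LCFunction.continuation_of_one_lt_re hz,
      div_eq_iff (Complex.Gamma_ne_zero_of_re_pos (zero_lt_one.trans hz)), mul_comm]
    exact (LCFunction.Gamma_mul_LSum hρ hC hA hP hAn hz).symm
  · refine DifferentiableOn.analyticOnNhd (fun z hz => ?_) isOpen_compl_singleton
    exact (LCFunction.differentiableAt_continuation hM hJ hMJ hz).differentiableWithinAt
  · exact LCFunction.meromorphicOrderAt_continuation hJ hMJ (by simpa [hJ1] using h0)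
  · simpa [hJ1] using LCFunction.tendsto_sub_one_mul_continuation hJ hMJ
  · exact LCFunction.differentiable_continuation hM hJ hMJ (by simp [hJ1, h0])
  · rw [hI ε hε hε2]
    exact ⟨fun h => LCFunction.continuation_eq hMJ h,
      LCFunction.tendsto_Gamma_one_sub_mul hM hJ hMJ hz⟩
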